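/- Let $p\ge 3$ and $n\ge 1$ be integers, and let $X\sim N_p(\theta,\sigma^2 I_p)$ and $S\sim\sigma^2\chi^2_n$ be independent, with $\theta\in\mathbb R^p$ and $\sigma>0$ unknown. Put $W=\|X\|^2/S$ and $$\delta_\phi=\Bigl(1-\frac{\phi(W)}{W}\Bigr)X,\qquad R(\delta_\phi)=E\|\delta_\phi-\theta\|^2,\qquad R^*(\delta_\phi)=p\sigma^2-R(\delta_\phi).$$ Assume that $\phi$ is locally absolutely continuous on $(0,\infty)$ and that, with $$h(t)=(p-2)\frac{\phi(t)}{t}+2\phi'(t),$$ the integral $$g(w)=w^{n/2}\int_w^\infty t^{-n/2}\,\frac{h(t)}{t}\,dt$$ converges absolutely for every $w>0$. Assume moreover that $\delta_\phi$ improves on $X$, i.e. $R(\delta_\phi)\le E\|X-\theta\|^2=p\sigma^2$ for all $\theta$ and $\sigma$, and that $R^*(\delta_\phi)/\sigma^2$ (which depends only on $\lambda=\|\theta\|^2/\sigma^2$) is maximal at $\lambda=0$; let $\alpha_{p,n}$ denote its value at $\lambda=0$. Put $$a(w)=\frac np\Bigl(g(w)-\frac{\phi(w)^2}{w}\Bigr),\qquad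 \hat R^*_0=\frac{pS}{n}\,a(W),\qquad \hat R^*(\psi)=\frac{pS}{n}\,a(W)\psi(W)$$ for a function $\psi$ on $(0,\infty)$. (The expression $\hat R^*_0$ is the known formula for the UMVUE of $R^*(\delta_\phi)$; that fact is not part of the claim.) Let $$\psi_2(w)=\min\Bigl(1,\frac{\alpha_{p,n}}{p\,a(w)}\Bigr),$$ to be read as $1$ where $a(w)\le 0$. An estimator $T(X,S)$ of $R^*(\delta_\phi)$ is said to improve on $T'(X,S)$ if $E(T-R^*(\delta_\phi))^2\le E(T'-R^*(\delta_\phi))^2$ (values in $[0,\infty]$) for all $\theta\in\mathbb R^p$ and $\sigma>0$. **Theorem.** Suppose that $a$ is nonincreasing on $(0,\infty)$. 1. If $\psi$ is nondecreasing on $(0,\infty)$ with $\lim_{w\to\infty}\psi(w)=1$ and $\psi(w)\ge\psi_2(w)$ for all $w>0$, then $\hat R^*(\psi)$ improves on $\hat R^*_0$. 2. In particular, $\hat R^*(\psi_2)$ improves on $\hat R^*_0$. 3. The resulting estimator of the MSE, $\hat R(\psi_2)=\frac{pS}{n}-\hat R^*(\psi_2)=\frac{pS}{n}\bigl(1-a(W)\psi_2(W)\bigr)$,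 is positive whenever $S>0$. -/

import Mathlib

open MeasureTheory ProbabilityTheory Set Filter Topology
open scoped ENNReal

namespace ShrinkageMSE

/-- The chi-square distribution with `n` degrees of freedom, i.e. the Gamma law with shape `n / 2`
and rate `1 / 2`. -/
noncomputable def chiSquared (n : ℕ) : Measure ℝ :=
  gammaMeasure ((n : ℝ) / 2) (1 / 2)

/-- The joint law of `(X, S)` with `X ∼ N_p(θ, σ² I_p)` and `S ∼ σ² χ²_n` independent. -/
noncomputable def model (p n : ℕ) (θ : EuclideanSpace ℝ (Fin p)) (σ : ℝ) :
    Measure (EuclideanSpace ℝ (Fin p) × ℝ) :=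
  (multivariateGaussian θ (σ ^ 2 • (1 : Matrix (Fin p) (Fin p) ℝ))).prod
    ((chiSquared n).map (fun v => σ ^ 2 * v))

/-- The statistic `W = ‖X‖² / S`. -/
noncomputable def statW {p : ℕ} (z : EuclideanSpace ℝ (Fin p) × ℝ) : ℝ :=
  ‖z.1‖ ^ 2 / z.2

/-- The shrinkage estimator `δ_φ = (1 - φ(W) / W) X`. -/
noncomputable def shrinkage {p : ℕ} (φ : ℝ → ℝ) (z : EuclideanSpace ℝ (Fin p) × ℝ) :
    EuclideanSpace ℝ (Fin p) :=
  (1 - φ (statW z) / statW z) • z.1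

/-- The mean squared error `E ‖δ(X, S) - θ‖²` (the trace of the MSE matrix), as an extended
nonnegative real. -/
noncomputable def mse {p : ℕ} (n : ℕ)
    (δ : EuclideanSpace ℝ (Fin p) × ℝ → EuclideanSpace ℝ (Fin p))
    (θ : EuclideanSpace ℝ (Fin p)) (σ : ℝ) : ℝ≥0∞ :=
  ∫⁻ z, ENNReal.ofReal (‖δ z - θ‖ ^ 2) ∂(model p n θ σ)

/-- `δ` improves on `δ'` as an estimator of `θ` under squared error loss. -/
def ImprovesAsMeanEstimator {p : ℕ} (n : ℕ)
    (δ δ' : EuclideanSpace ℝ (Fin p) × ℝ → EuclideanSpace ℝ (Fin p)) : Prop :=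
  ∀ (θ : EuclideanSpace ℝ (Fin p)) (σ : ℝ), 0 < σ → mse n δ θ σ ≤ mse n δ' θ σ

/-- The risk reduction `R*(δ) = p σ² - R(δ)`. (Only used for `δ` of finite MSE.) -/
noncomputable def riskReduction {p : ℕ} (n : ℕ)
    (δ : EuclideanSpace ℝ (Fin p) × ℝ → EuclideanSpace ℝ (Fin p))
    (θ : EuclideanSpace ℝ (Fin p)) (σ : ℝ) : ℝ :=
  (p : ℝ) * σ ^ 2 - (mse n δ θ σ).toReal

/-- `α_{p,n}(δ_φ)`: the value of `R*(δ_φ) / σ²` at `λ = ‖θ‖² / σ² = 0`. By scale equivariance of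
`δ_φ` it does not depend on `σ`, so it is evaluated at `σ = 1`. -/
noncomputable def alpha (p n : ℕ) (φ : ℝ → ℝ) : ℝ :=
  riskReduction n (shrinkage (p := p) φ) 0 1

/-- `h(t) = (p - 2) φ(t) / t + 2 φ'(t)`. -/
noncomputable def hFun (p : ℕ) (φ : ℝ → ℝ) (t : ℝ) : ℝ :=
  ((p : ℝ) - 2) * (φ t / t) + 2 * deriv φ t

/-- `g(w) = w^{n/2} ∫_w^∞ t^{-n/2} h(t) / t dt`. -/
noncomputable def gFun (p n : ℕ) (φ : ℝ → ℝ) (w : ℝ) : ℝ :=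
  w ^ ((n : ℝ) / 2) * ∫ t in Ioi w, t ^ (-((n : ℝ) / 2)) * (hFun p φ t / t)

/-- `a(w) = (n / p) (g(w) - φ(w)² / w)`. -/
noncomputable def aFun (p n : ℕ) (φ : ℝ → ℝ) (w : ℝ) : ℝ :=
  (n : ℝ) / p * (gFun p n φ w - φ w ^ 2 / w)

/-- `φ` is locally absolutely continuous on `(0, ∞)` (so that `φ'` exists and is finite almost
everywhere and `φ` is its primitive), and the integral defining `g` converges. -/
structure Regular (p n : ℕ) (φ : ℝ → ℝ) : Prop where
  absolutelyContinuous :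
    ∀ u v : ℝ, 0 < u → u ≤ v → AbsolutelyContinuousOnInterval φ u v
  integrable :
    ∀ w : ℝ, 0 < w →
      IntegrableOn (fun t : ℝ => t ^ (-((n : ℝ) / 2)) * (hFun p φ t / t)) (Ioi w)

/-- The estimator `R̂*(ψ; δ_φ) = (p S / n) a(W) ψ(W)` of the risk reduction. -/
noncomputable def reductionEstimator {p : ℕ} (n : ℕ) (φ ψ : ℝ → ℝ)
    (z : EuclideanSpace ℝ (Fin p) × ℝ) : ℝ :=
  (p : ℝ) * z.2 / n * aFun p n φ (statW z) * ψ (statW z)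

/-- The estimator `R̂*₀(δ_φ) = (p S / n) a(W)` of the risk reduction. -/
noncomputable def unbiasedReductionEstimator {p : ℕ} (n : ℕ) (φ : ℝ → ℝ)
    (z : EuclideanSpace ℝ (Fin p) × ℝ) : ℝ :=
  (p : ℝ) * z.2 / n * aFun p n φ (statW z)

/-- The estimator `R̂(ψ; δ_φ) = (p S / n) (1 - a(W) ψ(W))` of the MSE. -/
noncomputable def mseEstimator {p : ℕ} (n : ℕ) (φ ψ : ℝ → ℝ)
    (z : EuclideanSpace ℝ (Fin p) × ℝ) : ℝ :=
  (p : ℝ) * z.2 / n * (1 - aFun p n φ (statW z) * ψ (statW z))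

/-- The risk `E (T(X, S) - R*(δ_φ))²` of an estimator `T` of the risk reduction, possibly `∞`. -/
noncomputable def reductionRisk {p : ℕ} (n : ℕ) (φ : ℝ → ℝ)
    (T : EuclideanSpace ℝ (Fin p) × ℝ → ℝ)
    (θ : EuclideanSpace ℝ (Fin p)) (σ : ℝ) : ℝ≥0∞ :=
  ∫⁻ z, ENNReal.ofReal ((T z - riskReduction n (shrinkage φ) θ σ) ^ 2) ∂(model p n θ σ)

/-- `T` improves on `T'` as an estimator of `R*(δ_φ)` under squared error loss. -/
def ImprovesAsReductionEstimator {p : ℕ} (n : ℕ) (φ : ℝ → ℝ)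
    (T T' : EuclideanSpace ℝ (Fin p) × ℝ → ℝ) : Prop :=
  ∀ (θ : EuclideanSpace ℝ (Fin p)) (σ : ℝ), 0 < σ →
    reductionRisk n φ T θ σ ≤ reductionRisk n φ T' θ σ

/-- `ψ₂(w) = min (1, α_{p,n}(δ_φ) / (p a(w)))`, read as `1` where `a(w)` is not positive, so that
`a ψ₂ = min (a, α_{p,n}(δ_φ) / p)` whenever `α_{p,n}(δ_φ) ≥ 0`. -/
noncomputable def psiTwo (p n : ℕ) (φ : ℝ → ℝ) (w : ℝ) : ℝ :=
  open scoped Classical in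
  if 0 < aFun p n φ w then min 1 (alpha p n φ / (p * aFun p n φ w)) else 1

end ShrinkageMSE

namespace ShrinkageMSE

/-! ### Gamma and chi-square moments -/

/-! Condition on `X`, so that only `S` is random, and put k = p/n and m = E S = nσ², so km = pσ².
Wherever ψ < 1, the bound ψ ≥ ψ₂ forces a > 0 and R* ≤ ασ² ≤ k m a ψ. Inserting this into the
difference of the squared errors leaves at least k² f(W) S(S − m), with f = (1 − ψ²)a² where ψ < 1
and 0 elsewhere (`sq_error_add_le`). Since f is nonincreasing in W = ‖X‖²/S, it is nondecreasing in
S, so f(W)(S − m) ≥ c(S − m), where c is the value of f at S = m. The expected gain is thus at least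
k² c (E S² − m²) ≥ 0 (`lintegral_sq_error_le`), and Tonelli removes the conditioning.

Positivity of the MSE estimator amounts to aψ₂ < 1, which follows from α < p, that is, from a
nonzero MSE at θ = 0. A zero MSE would force φ(w) = w, hence δ = 0, whose MSE ‖θ‖² is unbounded. -/

lemma ofReal_mul_gammaPDF {a r : ℝ} (ha : 0 < a) (hr : 0 < r) (x : ℝ) :
    ENNReal.ofReal x * gammaPDF a r x = ENNReal.ofReal (a / r) * gammaPDF (a + 1) r x := by
  rcases lt_or_ge x 0 with hx | hx
  · simp [gammaPDF_of_neg hx]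
  rw [gammaPDF_of_nonneg hx, gammaPDF_of_nonneg hx, ← ENNReal.ofReal_mul hx,
    ← ENNReal.ofReal_mul (by positivity)]
  congr 1
  have hG := (Real.Gamma_pos_of_pos ha).ne'
  have hx' : x ^ (a + 1 - 1) = x * x ^ (a - 1) := by
    rcases hx.eq_or_lt with rfl | hx
    · simp [ha.ne']
    · rw [mul_comm, ← Real.rpow_add_one hx.ne']
      congr 1
      ring
  rw [Real.Gamma_add_one ha.ne', hx', Real.rpow_add_one hr.ne']
  field_simp

lemma lintegral_ofReal_gammaMeasure {a r : ℝ} (ha : 0 < a) (hr : 0 < r) :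
    ∫⁻ x, ENNReal.ofReal x ∂gammaMeasure a r = ENNReal.ofReal (a / r) := by
  have hm (b : ℝ) : Measurable (gammaPDF b r) := (measurable_gammaPDFReal b r).ennreal_ofReal
  rw [gammaMeasure, lintegral_withDensity_eq_lintegral_mul _ (hm a) ENNReal.measurable_ofReal]
  simp only [Pi.mul_apply, mul_comm (gammaPDF a r _), ofReal_mul_gammaPDF ha hr]
  rw [lintegral_const_mul _ (hm _), lintegral_gammaPDF_eq_one (by positivity) hr, mul_one]

lemma lintegral_ofReal_sq_gammaMeasure {a r : ℝ} (ha : 0 < a) (hr : 0 < r) :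
    ∫⁻ x, ENNReal.ofReal x ^ 2 ∂gammaMeasure a r = ENNReal.ofReal (a / r * ((a + 1) / r)) := by
  have hm (b : ℝ) : Measurable (gammaPDF b r) := (measurable_gammaPDFReal b r).ennreal_ofReal
  rw [gammaMeasure, lintegral_withDensity_eq_lintegral_mul _ (hm a)
    (ENNReal.measurable_ofReal.pow_const 2)]
  have h (x : ℝ) : gammaPDF a r x * ENNReal.ofReal x ^ 2 =
      ENNReal.ofReal (a / r * ((a + 1) / r)) * gammaPDF (a + 1 + 1) r x := by
    rw [pow_two, mul_comm, mul_assoc, ofReal_mul_gammaPDF ha hr, mul_left_comm,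
      ofReal_mul_gammaPDF (by positivity) hr, ← mul_assoc, ← ENNReal.ofReal_mul (by positivity)]
  simp only [Pi.mul_apply, h]
  rw [lintegral_const_mul _ (hm _), lintegral_gammaPDF_eq_one (by positivity) hr, mul_one]

lemma ae_pos_gammaMeasure (a r : ℝ) : ∀ᵐ x ∂gammaMeasure a r, 0 < x := by
  have hm : Measurable (gammaPDF a r) := (measurable_gammaPDFReal a r).ennreal_ofReal
  rw [gammaMeasure, ae_withDensity_iff hm]
  filter_upwards [Measure.ae_ne volume (0 : ℝ)] with x hx0 hx
  by_contra h
  exact hx (gammaPDF_of_neg (lt_of_le_of_ne (not_lt.1 h) hx0))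

/-- The Gamma density is strictly positive on the half-line, so its null sets there are Lebesgue
null. -/
lemma ae_volume_of_ae_gammaMeasure {a r : ℝ} (ha : 0 < a) (hr : 0 < r) {P : ℝ → Prop}
    (h : ∀ᵐ x ∂gammaMeasure a r, P x) : ∀ᵐ x, 0 < x → P x := by
  have hm : Measurable (gammaPDF a r) := (measurable_gammaPDFReal a r).ennreal_ofReal
  rw [gammaMeasure, ae_withDensity_iff hm] at h
  filter_upwards [h] with x hx hx0
  exact hx (ENNReal.ofReal_pos.2 (gammaPDFReal_pos ha hr hx0)).ne'

lemma isProbabilityMeasure_chiSquared {n : ℕ} (hn : 1 ≤ n) :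
    IsProbabilityMeasure (chiSquared n) :=
  isProbabilityMeasure_gammaMeasure (by positivity) (by norm_num)

lemma isProbabilityMeasure_scaledChiSquared {n : ℕ} (hn : 1 ≤ n) (σ : ℝ) :
    IsProbabilityMeasure ((chiSquared n).map (fun v => σ ^ 2 * v)) := by
  have := isProbabilityMeasure_chiSquared hn
  exact Measure.isProbabilityMeasure_map (by fun_prop)

lemma ae_pos_scaledChiSquared (n : ℕ) {σ : ℝ} (hσ : 0 < σ) :
    ∀ᵐ s ∂(chiSquared n).map (fun v => σ ^ 2 * v), 0 < s := by
  rw [ae_map_iff (by fun_prop) measurableSet_Ioi]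
  filter_upwards [ae_pos_gammaMeasure ((n : ℝ) / 2) (1 / 2)] with v hv
  positivity

lemma lintegral_ofReal_scaledChiSquared {n : ℕ} (hn : 1 ≤ n) (σ : ℝ) :
    ∫⁻ s, ENNReal.ofReal s ∂(chiSquared n).map (fun v => σ ^ 2 * v)
      = ENNReal.ofReal (n * σ ^ 2) := by
  rw [lintegral_map (by fun_prop) (by fun_prop)]
  simp_rw [ENNReal.ofReal_mul (sq_nonneg σ)]
  rw [lintegral_const_mul _ (by fun_prop), chiSquared,
    lintegral_ofReal_gammaMeasure (by positivity) (by norm_num),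
    ← ENNReal.ofReal_mul (sq_nonneg σ)]
  congr 1
  field_simp

lemma lintegral_ofReal_sq_scaledChiSquared {n : ℕ} (hn : 1 ≤ n) (σ : ℝ) :
    ∫⁻ s, ENNReal.ofReal s ^ 2 ∂(chiSquared n).map (fun v => σ ^ 2 * v)
      = ENNReal.ofReal (n * (n + 2) * σ ^ 4) := by
  rw [lintegral_map (by fun_prop) (by fun_prop)]
  simp_rw [ENNReal.ofReal_mul (sq_nonneg σ), mul_pow]
  rw [lintegral_const_mul _ (by fun_prop), chiSquared,
    lintegral_ofReal_sq_gammaMeasure (by positivity) (by norm_num),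
    ← ENNReal.ofReal_pow (sq_nonneg σ), ← ENNReal.ofReal_mul (by positivity)]
  congr 1
  field_simp

/-! ### The Gaussian factor -/

lemma posSemidef_sq_smul_one (p : ℕ) (σ : ℝ) :
    (σ ^ 2 • (1 : Matrix (Fin p) (Fin p) ℝ)).PosSemidef :=
  Matrix.PosSemidef.one.smul (sq_nonneg σ)

lemma ae_ne_zero_multivariateGaussian {p : ℕ} (hp : 0 < p) (θ : EuclideanSpace ℝ (Fin p))
    {σ : ℝ} (hσ : 0 < σ) :
    ∀ᵐ x ∂multivariateGaussian θ (σ ^ 2 • (1 : Matrix (Fin p) (Fin p) ℝ)), x ≠ 0 := by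
  have hmp := measurePreserving_eval_multivariateGaussian (μ := θ) (posSemidef_sq_smul_one p σ)
    (i := (⟨0, hp⟩ : Fin p))
  have hv : ((σ ^ 2 • (1 : Matrix (Fin p) (Fin p) ℝ)) ⟨0, hp⟩ ⟨0, hp⟩).toNNReal ≠ 0 := by
    simp [hσ.ne']
  have := nullSingletonClass_gaussianReal (μ := θ ⟨0, hp⟩) hv
  have h := hmp.quasiMeasurePreserving.ae (Measure.ae_ne _ (0 : ℝ))
  filter_upwards [h] with x hx hx0
  simp [hx0] at hx

lemma lintegral_norm_sub_sq_multivariateGaussian {p : ℕ} (θ : EuclideanSpace ℝ (Fin p)) (σ : ℝ) :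
    ∫⁻ x, ENNReal.ofReal (‖x - θ‖ ^ 2)
      ∂multivariateGaussian θ (σ ^ 2 • (1 : Matrix (Fin p) (Fin p) ℝ))
      = ENNReal.ofReal (p * σ ^ 2) := by
  set μ := multivariateGaussian θ (σ ^ 2 • (1 : Matrix (Fin p) (Fin p) ℝ)) with hμ
  have hL (i : Fin p) : MemLp (fun x : EuclideanSpace ℝ (Fin p) => x i) 2 μ :=
    (EuclideanSpace.proj (𝕜 := ℝ) i).comp_memLp' IsGaussian.memLp_two_id
  have hmean (i : Fin p) : ∫ x, x i ∂μ = θ i := by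
    have := (EuclideanSpace.proj (𝕜 := ℝ) i).integral_comp_comm
      (IsGaussian.integrable_id (μ := μ))
    simpa [hμ] using this
  have hi (i : Fin p) : ∫⁻ x, ENNReal.ofReal ((x i - θ i) ^ 2) ∂μ = ENNReal.ofReal (σ ^ 2) := by
    have h1 := variance_eval_multivariateGaussian (μ := θ) (posSemidef_sq_smul_one p σ) i
    have h2 := (hL i).ofReal_variance_eq
    rw [← hμ] at h1
    rw [h1, evariance_eq_lintegral_ofReal] at h2
    simpa [hmean] using h2.symm
  have hsum (x : EuclideanSpace ℝ (Fin p)) :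
      ENNReal.ofReal (‖x - θ‖ ^ 2) = ∑ i, ENNReal.ofReal ((x i - θ i) ^ 2) := by
    rw [← ENNReal.ofReal_sum_of_nonneg (fun _ _ => sq_nonneg _), EuclideanSpace.norm_sq_eq]
    simp
  simp_rw [hsum]
  rw [lintegral_finsetSum _ (fun i _ => by fun_prop)]
  simp_rw [hi]
  rw [ENNReal.ofReal_mul (by positivity)]
  simp

/-! ### Measurability of functions given on the positive half-line -/

/-- Nothing is known about ψ, a or φ off (0, ∞). Since W > 0 almost surely, the truncation suffices
for a.e. measurability. -/
lemma measurable_indicator_of_restrict {f : ℝ → ℝ}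
    (hf : Measurable ((Ioi (0 : ℝ)).domRestrict f)) : Measurable ((Ioi (0 : ℝ)).indicator f) := by
  refine measurable_of_restrict_of_restrict_compl (s := Ioi 0) measurableSet_Ioi ?_ ?_
  · convert hf using 1
    ext x
    simp [x.2]
  · convert measurable_const (a := (0 : ℝ)) using 1
    ext x
    exact indicator_of_notMem x.2 f

lemma _root_.MonotoneOn.measurable_indicator_Ioi {f : ℝ → ℝ} (hf : MonotoneOn f (Ioi 0)) :
    Measurable ((Ioi (0 : ℝ)).indicator f) :=
  measurable_indicator_of_restrict (Monotone.measurable (monotoneOn_iff_monotone.1 hf))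

lemma _root_.AntitoneOn.measurable_indicator_Ioi {f : ℝ → ℝ} (hf : AntitoneOn f (Ioi 0)) :
    Measurable ((Ioi (0 : ℝ)).indicator f) :=
  measurable_indicator_of_restrict (Antitone.measurable (antitoneOn_iff_antitone.1 hf))

lemma _root_.ContinuousOn.measurable_indicator_Ioi {f : ℝ → ℝ} (hf : ContinuousOn f (Ioi 0)) :
    Measurable ((Ioi (0 : ℝ)).indicator f) :=
  measurable_indicator_of_restrict hf.domRestrict.measurable

/-! ### Almost sure properties of (X, S) and the risk of X -/

section Model

variable {p n : ℕ}

lemma ae_model (hp : 0 < p) (hn : 1 ≤ n) (θ : EuclideanSpace ℝ (Fin p)) {σ : ℝ} (hσ : 0 < σ) :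
    ∀ᵐ z ∂model p n θ σ, z.1 ≠ 0 ∧ 0 < z.2 := by
  have := isProbabilityMeasure_scaledChiSquared hn σ
  exact (Measure.quasiMeasurePreserving_fst.ae (ae_ne_zero_multivariateGaussian hp θ hσ)).and
    (Measure.quasiMeasurePreserving_snd.ae (ae_pos_scaledChiSquared n hσ))

lemma statW_pos {z : EuclideanSpace ℝ (Fin p) × ℝ} (h₁ : z.1 ≠ 0) (h₂ : 0 < z.2) :
    0 < statW z :=
  div_pos (pow_pos (norm_pos_iff.2 h₁) 2) h₂

lemma measurable_statW : Measurable (statW (p := p)) := by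
  unfold statW
  fun_prop

lemma aemeasurable_comp_statW (hp : 0 < p) (hn : 1 ≤ n) (θ : EuclideanSpace ℝ (Fin p)) {σ : ℝ}
    (hσ : 0 < σ) {f : ℝ → ℝ} (hf : Measurable ((Ioi (0 : ℝ)).indicator f)) :
    AEMeasurable (fun z => f (statW z)) (model p n θ σ) := by
  refine ⟨_, hf.comp measurable_statW, ?_⟩
  filter_upwards [ae_model hp hn θ hσ] with z hz
  simp [indicator_of_mem (mem_Ioi.2 (statW_pos hz.1 hz.2))]

lemma mse_fst (hn : 1 ≤ n) (θ : EuclideanSpace ℝ (Fin p)) (σ : ℝ) :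
    mse n (fun z => z.1) θ σ = ENNReal.ofReal (p * σ ^ 2) := by
  have := isProbabilityMeasure_scaledChiSquared hn σ
  rw [mse, model, lintegral_prod _ (by fun_prop)]
  simp only [lintegral_const, measure_univ, mul_one]
  exact lintegral_norm_sub_sq_multivariateGaussian θ σ

end Model

/-! ### Comparison of the two estimators of the risk reduction -/

/-- Pointwise comparison of the squared errors of `k s a` and `k s a q` as estimators of `R`;
the correction term `c * k ^ 2 * s * (s - m)` has nonnegative expectation. -/
lemma sq_error_add_le {k s a q R c m : ℝ} (hk : 0 ≤ k) (hs : 0 ≤ s) (hq : q ≤ 1)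
    (hR : q < 1 → 0 < a ∧ R ≤ k * m * (a * q))
    (hm : 0 ≤ m)
    (hc : c * (s * (s - m)) ≤ (if q < 1 then (1 - q ^ 2) * a ^ 2 else 0) * (s * (s - m))) :
    (k * s * a * q - R) ^ 2 + c * k ^ 2 * s ^ 2 ≤ (k * s * a - R) ^ 2 + c * k ^ 2 * m * s := by
  have hc' := mul_le_mul_of_nonneg_left hc (sq_nonneg k)
  rcases hq.eq_or_lt with rfl | hq
  · simp only [lt_irrefl, if_false] at hc'
    nlinarith
  · obtain ⟨ha, hR⟩ := hR hq
    rw [if_pos hq] at hc'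
    have h₁ : (1 - q) * (k * s * a) * R ≤ (1 - q) * (k * s * a) * (k * m * (a * q)) :=
      mul_le_mul_of_nonneg_left hR
        (mul_nonneg (sub_nonneg.2 hq.le) (mul_nonneg (mul_nonneg hk hs) ha.le))
    -- This is the surplus left after R is replaced by its bound: (1 − q²) − 2q(1 − q) = (1 − q)².
    have h₂ : 0 ≤ (1 - q) ^ 2 * (k ^ 2 * a ^ 2 * (m * s)) := by positivity
    nlinarith

/-- Both factors are nonnegative and nonincreasing where ψ < 1; positivity of a is what lets its
square inherit monotonicity. Once ψ reaches 1 it stays at least 1, and the weight stays 0. -/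
lemma antitoneOn_weight {a ψ : ℝ → ℝ} (ha : AntitoneOn a (Ioi 0)) (hψ : MonotoneOn ψ (Ioi 0))
    (hψ0 : ∀ w, 0 < w → 0 ≤ ψ w) (hpos : ∀ w, 0 < w → ψ w < 1 → 0 < a w) :
    AntitoneOn (fun w => if ψ w < 1 then (1 - ψ w ^ 2) * a w ^ 2 else 0) (Ioi 0) := by
  intro w hw v hv hwv
  have h := hψ hw hv hwv
  have h0 := hψ0 w hw
  have h0' := hψ0 v hv
  by_cases h1 : ψ v < 1
  · simp only [h1, h.trans_lt h1, if_true]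
    have h2 := hpos v hv h1
    have h3 := ha hw hv hwv
    gcongr
    nlinarith
  · simp only [h1, if_false]
    split_ifs with h2
    · exact mul_nonneg (by nlinarith) (sq_nonneg _)
    · exact le_rfl

lemma lintegral_sq_error_le {n : ℕ} (hn : 1 ≤ n) {σ k r R : ℝ} (hσ : 0 < σ) (hk : 0 ≤ k)
    (hr : 0 < r) {a ψ : ℝ → ℝ} (ha : AntitoneOn a (Ioi 0)) (hψ : MonotoneOn ψ (Ioi 0))
    (hψ0 : ∀ w, 0 < w → 0 ≤ ψ w) (hψ1 : ∀ w, 0 < w → ψ w ≤ 1)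
    (hR : ∀ w, 0 < w → ψ w < 1 → 0 < a w ∧ R ≤ k * (n * σ ^ 2) * (a w * ψ w)) :
    ∫⁻ s, ENNReal.ofReal ((k * s * a (r / s) * ψ (r / s) - R) ^ 2)
        ∂(chiSquared n).map (fun v => σ ^ 2 * v)
      ≤ ∫⁻ s, ENNReal.ofReal ((k * s * a (r / s) - R) ^ 2)
        ∂(chiSquared n).map (fun v => σ ^ 2 * v) := by
  set ν := (chiSquared n).map (fun v => σ ^ 2 * v)
  set f : ℝ → ℝ := fun w => if ψ w < 1 then (1 - ψ w ^ 2) * a w ^ 2 else 0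
  have hf : AntitoneOn f (Ioi 0) := antitoneOn_weight ha hψ hψ0 fun w hw h => (hR w hw h).1
  have hn' : (0 : ℝ) < n := by exact_mod_cast hn
  set m : ℝ := n * σ ^ 2
  have hm : 0 < m := by positivity
  -- The weight at s = m, where s − m changes sign.
  set c := f (r / m)
  have hc : 0 ≤ c := by
    have h0 := hψ0 (r / m) (by positivity)
    simp only [c, f]
    split_ifs with h
    · exact mul_nonneg (by nlinarith) (sq_nonneg _)
    · exact le_rfl
  set C := ENNReal.ofReal (c * k ^ 2)
  -- The term c k² s(s − m) is split between the two sides, so that no subtraction occurs among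
  -- possibly infinite integrals.
  have key : ∀ᵐ s ∂ν,
      ENNReal.ofReal ((k * s * a (r / s) * ψ (r / s) - R) ^ 2) + C * ENNReal.ofReal s ^ 2
        ≤ ENNReal.ofReal ((k * s * a (r / s) - R) ^ 2)
          + C * ENNReal.ofReal m * ENNReal.ofReal s := by
    filter_upwards [ae_pos_scaledChiSquared n hσ] with s hs
    have hw : 0 < r / s := div_pos hr hs
    have hcs : c * (s * (s - m)) ≤ f (r / s) * (s * (s - m)) := by
      rcases le_total m s with h | h
      · exact mul_le_mul_of_nonneg_right
          (hf hw (div_pos hr hm) (div_le_div_of_nonneg_left hr.le hm h))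
          (mul_nonneg hs.le (sub_nonneg.2 h))
      · exact mul_le_mul_of_nonpos_right
          (hf (div_pos hr hm) hw (div_le_div_of_nonneg_left hr.le hs h))
          (mul_nonpos_of_nonneg_of_nonpos hs.le (sub_nonpos.2 h))
    have := sq_error_add_le (a := a (r / s)) (q := ψ (r / s)) (R := R) hk hs.le (hψ1 _ hw)
      (hR _ hw) hm.le hcs
    simp only [C]
    rw [← ENNReal.ofReal_pow hs.le, ← ENNReal.ofReal_mul (by positivity),
      ← ENNReal.ofReal_mul (by positivity), ← ENNReal.ofReal_mul (by positivity),
      ← ENNReal.ofReal_add (sq_nonneg _) (by positivity),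
      ← ENNReal.ofReal_add (sq_nonneg _) (by positivity)]
    exact ENNReal.ofReal_le_ofReal this
  have h := lintegral_mono_ae key
  rw [lintegral_add_right _ (by fun_prop), lintegral_add_right _ (by fun_prop),
    lintegral_const_mul _ (by fun_prop), lintegral_const_mul _ (by fun_prop),
    lintegral_ofReal_scaledChiSquared hn, lintegral_ofReal_sq_scaledChiSquared hn, mul_assoc C,
    ← ENNReal.ofReal_mul hm.le] at h
  -- (E S)² ≤ E S², that is, n² ≤ n(n + 2).
  have hle : ENNReal.ofReal (m * (n * σ ^ 2)) ≤ ENNReal.ofReal (n * (n + 2) * σ ^ 4) := by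
    apply ENNReal.ofReal_le_ofReal
    simp only [m]
    nlinarith [mul_nonneg hn'.le (pow_nonneg hσ.le 4)]
  have hfin : C * ENNReal.ofReal (n * (n + 2) * σ ^ 4) ≠ ∞ :=
    ENNReal.mul_ne_top ENNReal.ofReal_ne_top ENNReal.ofReal_ne_top
  exact (ENNReal.add_le_add_iff_right hfin).1 (h.trans (by gcongr))

/-- The main comparison: shrinking by a nondecreasing `ψ` improves on the unbiased estimator as
soon as `a` is positive and `α ≤ p a ψ` wherever `ψ < 1`. -/
lemma improves_of_monotoneOn {p n : ℕ} (hp : 0 < p) (hn : 1 ≤ n) {φ ψ : ℝ → ℝ}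
    (hmax : ∀ (θ : EuclideanSpace ℝ (Fin p)) (σ : ℝ), 0 < σ →
      riskReduction n (shrinkage φ) θ σ / σ ^ 2 ≤ alpha p n φ)
    (ha : AntitoneOn (aFun p n φ) (Ioi 0)) (hψ : MonotoneOn ψ (Ioi 0))
    (hψ0 : ∀ w, 0 < w → 0 ≤ ψ w) (hψ1 : ∀ w, 0 < w → ψ w ≤ 1)
    (hα : ∀ w, 0 < w → ψ w < 1 →
      0 < aFun p n φ w ∧ alpha p n φ ≤ p * (aFun p n φ w * ψ w)) :
    ImprovesAsReductionEstimator (p := p) n φ (reductionEstimator n φ ψ)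
      (unbiasedReductionEstimator n φ) := by
  intro θ σ hσ
  have := isProbabilityMeasure_scaledChiSquared hn σ
  have hn' : (0 : ℝ) < n := by exact_mod_cast hn
  have ham := aemeasurable_comp_statW hp hn θ hσ ha.measurable_indicator_Ioi
  have hψm := aemeasurable_comp_statW hp hn θ hσ hψ.measurable_indicator_Ioi
  have hu : AEMeasurable (unbiasedReductionEstimator n φ) (model p n θ σ) :=
    AEMeasurable.mul (by fun_prop) ham
  set R := riskReduction n (shrinkage φ) θ σ with hRdef
  have hRα : R ≤ alpha p n φ * σ ^ 2 := (div_le_iff₀ (by positivity)).1 (hmax θ σ hσ)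
  have h₁ := ((hu.mul hψm).sub_const R).pow_const 2 |>.ennreal_ofReal
  have h₂ := (hu.sub_const R).pow_const 2 |>.ennreal_ofReal
  rw [reductionRisk, reductionRisk, ← hRdef]
  refine (lintegral_prod _ h₁).trans_le (le_trans ?_ (lintegral_prod _ h₂).ge)
  refine lintegral_mono_ae ?_
  filter_upwards [ae_ne_zero_multivariateGaussian hp θ hσ] with x hx
  have hr : 0 < ‖x‖ ^ 2 := pow_pos (norm_pos_iff.2 hx) 2
  have hmain := lintegral_sq_error_le hn (k := (p : ℝ) / n) (R := R) hσ (by positivity) hr ha hψ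
    hψ0 hψ1 fun w hw h => ⟨(hα w hw h).1, by
      refine hRα.trans ?_
      have := mul_le_mul_of_nonneg_right (hα w hw h).2 (sq_nonneg σ)
      refine this.trans_eq ?_
      field_simp⟩
  simpa only [Pi.mul_apply, unbiasedReductionEstimator, statW, div_mul_eq_mul_div] using hmain

/-! ### The bound `α` and the positivity of the MSE at the origin -/

lemma mse_shrinkage_zero_le {p n : ℕ} (hn : 1 ≤ n) {φ : ℝ → ℝ}
    (himp : ImprovesAsMeanEstimator n (shrinkage (p := p) φ) (fun z => z.1)) :
    mse n (shrinkage (p := p) φ) 0 1 ≤ p := by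
  simpa [mse_fst hn] using himp 0 1 one_pos

lemma alpha_nonneg {p n : ℕ} (hn : 1 ≤ n) {φ : ℝ → ℝ}
    (himp : ImprovesAsMeanEstimator n (shrinkage (p := p) φ) (fun z => z.1)) :
    0 ≤ alpha p n φ := by
  have h := ENNReal.toReal_mono (ENNReal.natCast_ne_top p) (mse_shrinkage_zero_le hn himp)
  simp only [ENNReal.toReal_natCast] at h
  simpa [alpha, riskReduction] using h

lemma Regular.continuousOn {p n : ℕ} {φ : ℝ → ℝ} (hφ : Regular p n φ) :
    ContinuousOn φ (Ioi 0) := by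
  intro w hw
  have hw : (0 : ℝ) < w := hw
  have h := (hφ.absolutelyContinuous (w / 2) (w + 1) (by linarith) (by linarith)).continuousOn
  rw [uIcc_of_le (by linarith)] at h
  exact (h.continuousAt (Icc_mem_nhds (by linarith) (by linarith))).continuousWithinAt

/-- If `φ(W) = W` almost surely, then `φ` is the identity on the positive half-line. -/
lemma eq_self_of_ae_model {p n : ℕ} (hp : 0 < p) (hn : 1 ≤ n) {φ : ℝ → ℝ}
    (hφ : ContinuousOn φ (Ioi 0))
    (h : ∀ᵐ z ∂model p n 0 1, φ (statW z) = statW z) : ∀ w, 0 < w → φ w = w := by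
  have := isProbabilityMeasure_scaledChiSquared hn 1
  -- One nonzero section x is enough: ‖x‖²/s sweeps (0, ∞) as s does, and continuity upgrades almost
  -- everywhere to everywhere.
  have h1 := (Measure.ae_ae_of_ae_prod h).and (ae_ne_zero_multivariateGaussian hp 0 one_pos)
  obtain ⟨x, hx, hx0⟩ := h1.exists
  have hr : 0 < ‖x‖ ^ 2 := pow_pos (norm_pos_iff.2 hx0) 2
  simp only [one_pow, one_mul, Measure.map_id', statW] at hx
  have hv := ae_volume_of_ae_gammaMeasure (by positivity) (by norm_num) hx
  have hg : ContinuousOn (fun s : ℝ => ‖x‖ ^ 2 / s) (Ioi 0) :=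
    continuousOn_const.div continuousOn_id fun s hs => (ne_of_gt hs)
  have heq : EqOn (fun s => φ (‖x‖ ^ 2 / s)) (fun s => ‖x‖ ^ 2 / s) (Ioi 0) := by
    refine Measure.eqOn_open_of_ae_eq (μ := volume) ?_ isOpen_Ioi
      (hφ.comp hg fun s hs => div_pos hr hs) hg
    rw [EventuallyEq, ae_restrict_iff' measurableSet_Ioi]
    exact hv
  intro w hw
  have := heq (div_pos hr hw)
  simpa [div_div_cancel₀ hr.ne'] using this

/-- Zero MSE at the origin makes φ the identity, so the estimator vanishes almost surely under every
θ and cannot improve on X for large θ. -/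
lemma mse_shrinkage_zero_ne_zero {p n : ℕ} (hp : 0 < p) (hn : 1 ≤ n) {φ : ℝ → ℝ}
    (hφ : Regular p n φ)
    (himp : ImprovesAsMeanEstimator n (shrinkage (p := p) φ) (fun z => z.1)) :
    mse n (shrinkage (p := p) φ) 0 1 ≠ 0 := by
  intro h0
  have hW : AEMeasurable (fun z => φ (statW z)) (model p n 0 1) :=
    aemeasurable_comp_statW hp hn 0 one_pos hφ.continuousOn.measurable_indicator_Ioi
  have hδ : AEMeasurable (shrinkage (p := p) φ) (model p n 0 1) :=
    ((hW.div measurable_statW.aemeasurable).const_sub 1).smul (by fun_prop)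
  rw [mse, lintegral_eq_zero_iff' (((hδ.sub_const 0).norm.pow_const 2).ennreal_ofReal)] at h0
  have hid : ∀ w, 0 < w → φ w = w := by
    refine eq_self_of_ae_model hp hn hφ.continuousOn ?_
    filter_upwards [h0, ae_model hp hn 0 one_pos] with z hz hz'
    have hw := statW_pos hz'.1 hz'.2
    have h1 : ‖shrinkage φ z‖ ^ 2 ≤ 0 := by simpa using hz
    have h2 : shrinkage φ z = 0 := norm_eq_zero.1 (by nlinarith [norm_nonneg (shrinkage φ z)])
    have h3 := (smul_eq_zero.1 h2).resolve_right hz'.1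
    field_simp at h3
    linarith
  -- Any θ with ‖θ‖² > p would do; here ‖θ‖² = (p + 1)².
  set θ : EuclideanSpace ℝ (Fin p) := PiLp.single 2 ⟨0, hp⟩ ((p : ℝ) + 1)
  have hθ : ‖θ‖ = p + 1 := by
    simp only [θ, PiLp.norm_single, Real.norm_eq_abs]
    exact abs_of_pos (by positivity)
  have := isProbabilityMeasure_scaledChiSquared hn 1
  have : IsProbabilityMeasure (model p n θ 1) := by unfold model; infer_instance
  have hmse : mse n (shrinkage (p := p) φ) θ 1 = ENNReal.ofReal (‖θ‖ ^ 2) := by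
    have : ∀ᵐ z ∂model p n θ 1, ENNReal.ofReal (‖shrinkage φ z - θ‖ ^ 2)
        = ENNReal.ofReal (‖θ‖ ^ 2) := by
      filter_upwards [ae_model hp hn θ one_pos] with z hz
      have hw := statW_pos hz.1 hz.2
      simp [shrinkage, hid _ hw, hw.ne']
    rw [mse, lintegral_congr_ae this]
    simp
  have h := himp θ 1 one_pos
  rw [hmse, mse_fst hn, ENNReal.ofReal_le_ofReal_iff (by positivity), hθ] at h
  nlinarith [(Nat.cast_nonneg p : (0 : ℝ) ≤ p)]

lemma alpha_lt {p n : ℕ} (hp : 0 < p) (hn : 1 ≤ n) {φ : ℝ → ℝ} (hφ : Regular p n φ)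
    (himp : ImprovesAsMeanEstimator n (shrinkage (p := p) φ) (fun z => z.1)) :
    alpha p n φ < p := by
  have h : 0 < (mse n (shrinkage (p := p) φ) 0 1).toReal :=
    ENNReal.toReal_pos (mse_shrinkage_zero_ne_zero hp hn hφ himp)
      ((mse_shrinkage_zero_le hn himp).trans_lt (ENNReal.natCast_lt_top p)).ne
  simpa [alpha, riskReduction] using h

/-! ### The function `ψ₂` -/

lemma psiTwo_le_one (p n : ℕ) (φ : ℝ → ℝ) (w : ℝ) : psiTwo p n φ w ≤ 1 := by
  unfold psiTwo
  split_ifs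
  · exact min_le_left _ _
  · exact le_rfl

lemma psiTwo_nonneg {p n : ℕ} {φ : ℝ → ℝ} (hα : 0 ≤ alpha p n φ) (w : ℝ) :
    0 ≤ psiTwo p n φ w := by
  unfold psiTwo
  split_ifs
  · exact le_min zero_le_one (by positivity)
  · exact zero_le_one

/-- The value 1 assigned where a ≤ 0 rules out that case when q < 1. A general q serves both ψ₂
itself and any ψ above it. -/
lemma psiTwo_lt_one_imp {p n : ℕ} (hp : 0 < p) {φ : ℝ → ℝ} {w q : ℝ} (hq : q < 1)
    (h : psiTwo p n φ w ≤ q) :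
    0 < aFun p n φ w ∧ alpha p n φ ≤ p * (aFun p n φ w * q) := by
  unfold psiTwo at h
  split_ifs at h with ha
  · refine ⟨ha, ?_⟩
    have h' : alpha p n φ / (p * aFun p n φ w) ≤ q :=
      (min_le_iff.1 h).resolve_left (not_le.2 hq)
    rw [div_le_iff₀ (by positivity)] at h'
    linarith
  · exact absurd h (not_le.2 hq)

lemma monotoneOn_psiTwo {p n : ℕ} (hp : 0 < p) {φ : ℝ → ℝ} (hα : 0 ≤ alpha p n φ)
    (ha : AntitoneOn (aFun p n φ) (Ioi 0)) : MonotoneOn (psiTwo p n φ) (Ioi 0) := by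
  intro w hw v hv hwv
  by_cases hav : 0 < aFun p n φ v
  · have hle := ha hw hv hwv
    rw [psiTwo, psiTwo, if_pos (hav.trans_le hle), if_pos hav]
    gcongr
  -- Where a is not positive, ψ₂ takes its largest value 1.
  · rw [psiTwo.eq_1 p n φ v, if_neg hav]
    exact psiTwo_le_one p n φ w

/-- The product is at most α/p where a > 0 and equals a ≤ 0 elsewhere. -/
lemma aFun_mul_psiTwo_lt_one {p n : ℕ} (hp : 0 < p) {φ : ℝ → ℝ} (hα : alpha p n φ < p) (w : ℝ) :
    aFun p n φ w * psiTwo p n φ w < 1 := by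
  have hp' : (0 : ℝ) < p := by exact_mod_cast hp
  unfold psiTwo
  split_ifs with ha
  · calc aFun p n φ w * min 1 (alpha p n φ / (p * aFun p n φ w))
        ≤ aFun p n φ w * (alpha p n φ / (p * aFun p n φ w)) := by
          gcongr
          exact min_le_right _ _
      _ = alpha p n φ / p := by field_simp
      _ < 1 := (div_lt_one hp').2 hα
  · linarith

end ShrinkageMSE

theorem mainTheorem3 (p n : ℕ) (hp : 3 ≤ p) (hn : 1 ≤ n) (φ : ℝ → ℝ)
    (hφ : ShrinkageMSE.Regular p n φ)
    (himp : ShrinkageMSE.ImprovesAsMeanEstimator n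
      (ShrinkageMSE.shrinkage (p := p) φ) (fun z => z.1))
    (hmax : ∀ (θ : EuclideanSpace ℝ (Fin p)) (σ : ℝ), 0 < σ →
      ShrinkageMSE.riskReduction n (ShrinkageMSE.shrinkage φ) θ σ / σ ^ 2
        ≤ ShrinkageMSE.alpha p n φ)
    (ha : AntitoneOn (ShrinkageMSE.aFun p n φ) (Set.Ioi 0)) :
    (∀ ψ : ℝ → ℝ, MonotoneOn ψ (Set.Ioi 0) → Filter.Tendsto ψ Filter.atTop (nhds 1) →
      (∀ w : ℝ, 0 < w → ShrinkageMSE.psiTwo p n φ w ≤ ψ w) →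
      ShrinkageMSE.ImprovesAsReductionEstimator (p := p) n φ
        (ShrinkageMSE.reductionEstimator n φ ψ)
        (ShrinkageMSE.unbiasedReductionEstimator n φ)) ∧
    ShrinkageMSE.ImprovesAsReductionEstimator (p := p) n φ
      (ShrinkageMSE.reductionEstimator n φ (ShrinkageMSE.psiTwo p n φ))
      (ShrinkageMSE.unbiasedReductionEstimator n φ) ∧
    ∀ z : EuclideanSpace ℝ (Fin p) × ℝ, 0 < z.2 →
      0 < ShrinkageMSE.mseEstimator n φ (ShrinkageMSE.psiTwo p n φ) z := by
  have hp0 : 0 < p := by omega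
  have hα := ShrinkageMSE.alpha_nonneg hn himp
  refine ⟨fun ψ hψ hlim hle => ?_, ?_, fun z hz => ?_⟩
  · refine ShrinkageMSE.improves_of_monotoneOn hp0 hn hmax ha hψ
      (fun w hw => (ShrinkageMSE.psiTwo_nonneg hα w).trans (hle w hw)) (fun w hw => ?_)
      (fun w hw h => ShrinkageMSE.psiTwo_lt_one_imp hp0 h (hle w hw))
    -- A nondecreasing function with limit 1 never exceeds 1.
    refine ge_of_tendsto hlim ?_
    filter_upwards [Filter.eventually_ge_atTop w] with v hv
    exact hψ hw (lt_of_lt_of_le hw hv) hv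
  · exact ShrinkageMSE.improves_of_monotoneOn hp0 hn hmax ha
      (ShrinkageMSE.monotoneOn_psiTwo hp0 hα ha) (fun w _ => ShrinkageMSE.psiTwo_nonneg hα w)
      (fun w _ => ShrinkageMSE.psiTwo_le_one p n φ w)
      (fun w _ h => ShrinkageMSE.psiTwo_lt_one_imp hp0 h le_rfl)
  -- The bound holds for every real w, so X = 0, where W = 0, needs no separate treatment.
  · have h := ShrinkageMSE.aFun_mul_psiTwo_lt_one hp0
      (ShrinkageMSE.alpha_lt hp0 hn hφ himp) (ShrinkageMSE.statW z)
    have hn' : (0 : ℝ) < n := by exact_mod_cast hn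
    exact mul_pos (by positivity) (sub_pos.2 h)
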